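/- Let $P_0=\mathbb R^2\times\{0\}\subset\mathbb R^3$, let $E\subset\mathbb R^2$ be a nonempty open set (identified with $E\times\{0\}\subset P_0$), and let $B:E\to\mathbb R^2$ be continuous. A collection of oriented lines is said to \emph{fiber} a set $\Omega\subset\mathbb R^3$ if there is a continuous unit vector field $V:\Omega\to S^2$ such that, for every $x\in\Omega$, the whole line $t\mapsto x+tV(x)$ lies in $\Omega$ and is an integral curve of $V$ (that is, $V(x+tV(x))=V(x)$ for all $t\in\mathbb R$), and the collection consists exactly of these lines, oriented by $V$. Then the collection of oriented lines $$\bigl\{\,(p,0)+t\,(B(p),1)\;:\;t\in\mathbb R\,\bigr\},\qquad p\in E,$$ fibers $\mathbb R^3\setminus(P_0\setminus E)$ if and only if both of the following hold: \begin{itemize} \item for any distinct points $p,q\in E$, $p-q$ is not a real multiple of $B(p)-B(q)$; \item for every sequence $(p_n)$ of points of $E$ that has no accumulation point in $E$ (that is, no subsequence converges to a point of $E$), $|p_n+tB(p_n)|\to\infty$ for every fixed $t\neq0$. \end{itemize} -/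

import Mathlib

open Filter Topology

namespace LineFibration

/-- The Euclidean plane `ℝ²`. -/
abbrev Plane : Type := EuclideanSpace ℝ (Fin 2)

/-- Euclidean space `ℝ³`. -/
abbrev Space : Type := EuclideanSpace ℝ (Fin 3)

/-- The vector `(p, z)` of `ℝ³ = ℝ² × ℝ`. -/
noncomputable def lift (p : Plane) (z : ℝ) : Space := !₂[p 0, p 1, z]

/-- The horizontal coordinate plane `P₀ = ℝ² × {0}`. -/
def plane₀ : Set Space := {x | x 2 = 0}

/-- The region `ℝ³ - (P₀ - E)`, where `E ⊆ ℝ²` is viewed as the subset `E × {0}` of `P₀`. -/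
def region (E : Set Plane) : Set Space := (plane₀ \ ((fun p => lift p 0) '' E))ᶜ

/-- The line `{x + t v | t ∈ ℝ}` (for `v ≠ 0`), oriented by `v`: an oriented line is recorded as
the pair consisting of its underlying set of points and its unit direction vector. -/
noncomputable def orientedLine (x v : Space) : Set Space × Space :=
  (Set.range (fun t : ℝ => x + t • v), ‖v‖⁻¹ • v)

/-- The vector field `V` (only its values on `Ω` matter) is a fibration of `Ω` by oriented lines:
it is a continuous unit vector field on `Ω`, and for every `x ∈ Ω` the whole oriented line
`t ↦ x + t V(x)` lies in `Ω` and is an integral curve of `V`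
(its velocity is `V(x)`, so this says that `V` has the value `V(x)` all along the line). -/
structure IsLineFibration (Ω : Set Space) (V : Space → Space) : Prop where
  continuousOn : ContinuousOn V Ω
  norm_eq_one : ∀ x ∈ Ω, ‖V x‖ = 1
  line_mem : ∀ x ∈ Ω, ∀ t : ℝ, x + t • V x ∈ Ω
  apply_line : ∀ x ∈ Ω, ∀ t : ℝ, V (x + t • V x) = V x

/-- The collection `L` of oriented lines fibers `Ω`: its members are exactly the fibers of a
fibration of `Ω` by oriented lines. -/
def Fibers (L : Set (Set Space × Space)) (Ω : Set Space) : Prop :=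
  ∃ V : Space → Space, IsLineFibration Ω V ∧ L = {l | ∃ x ∈ Ω, l = orientedLine x (V x)}

/-- The collection of the oriented lines `(p, 0) + t (B(p), 1)`, `p ∈ E`. -/
def graphLines (E : Set Plane) (B : Plane → Plane) : Set (Set Space × Space) :=
  {l | ∃ p ∈ E, l = orientedLine (lift p 0) (lift (B p) 1)}

end LineFibration

/-! At height `t` the lines trace the map `p ↦ p + t • B p` on `E`. The first condition says that
all these maps are injective, i.e. that no two lines meet; the second makes those with `t ≠ 0`
proper. Given a fibration, the direction field recovers `B p` at any point of the line through `p`.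
This rules out intersections and yields a continuous inverse on each plane `t ≠ 0`, hence
properness. Conversely, planar invariance of domain makes the image open and properness makes it
closed, so for `t ≠ 0` it is the whole plane (`image_add_smul_eq_univ`). Continuity of the field
needs a version of invariance of domain that is stable as `t` varies (`eventually_exists_mem`). It
is proved with continuous logarithms on the circle in place of degree theory. -/

namespace LineFibration

open Metric Set

/-! ### Continuous logarithms as a substitute for winding numbers -/

section ContinuousLog

variable {X : Type*} [TopologicalSpace X]

/-- The function `g` has a continuous logarithm. -/
def HasLog (g : X → ℂ) : Prop := ∃ h : X → ℂ, Continuous h ∧ ∀ u, Complex.exp (h u) = g u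

theorem HasLog.const {a : ℂ} (ha : a ≠ 0) : HasLog (fun _ : X => a) :=
  ⟨fun _ => Complex.log a, continuous_const, fun _ => Complex.exp_log ha⟩

/-- The quotient `g₁ / g₀` stays in the unit disc about `1`, where the principal logarithm is
continuous. -/
theorem hasLog_iff_of_norm_sub_lt {g₀ g₁ : X → ℂ} (h₀ : Continuous g₀) (h₁ : Continuous g₁)
    (h : ∀ u, ‖g₁ u - g₀ u‖ < ‖g₀ u‖) : HasLog g₁ ↔ HasLog g₀ := by
  have hne : ∀ u, g₀ u ≠ 0 := fun u hu => by
    have := h u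
    rw [hu, norm_zero] at this
    exact absurd this (norm_nonneg _).not_gt
  have hball : ∀ u, g₁ u / g₀ u ∈ Complex.slitPlane := fun u => by
    refine Complex.ball_one_subset_slitPlane ?_
    rw [mem_ball, dist_eq_norm, div_sub_one (hne u), norm_div, div_lt_one (norm_pos_iff.2 (hne u))]
    exact h u
  have hcont : Continuous fun u => Complex.log (g₁ u / g₀ u) :=
    (h₁.div h₀ hne).clog hball
  have hexp : ∀ u, Complex.exp (Complex.log (g₁ u / g₀ u)) = g₁ u / g₀ u := fun u =>
    Complex.exp_log (Complex.slitPlane_ne_zero (hball u))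
  have hne' : ∀ u, g₁ u ≠ 0 := fun u hu =>
    Complex.slitPlane_ne_zero (hball u) (by rw [hu, zero_div])
  constructor
  · rintro ⟨k, hk, hk'⟩
    refine ⟨fun u => k u - Complex.log (g₁ u / g₀ u), hk.sub hcont, fun u => ?_⟩
    rw [Complex.exp_sub, hk', hexp, div_div_cancel₀ (hne' u)]
  · rintro ⟨k, hk, hk'⟩
    refine ⟨fun u => k u + Complex.log (g₁ u / g₀ u), hk.add hcont, fun u => ?_⟩
    rw [Complex.exp_add, hk', hexp, mul_div_cancel₀ _ (hne u)]

/-- Compactness makes nearby stages uniformly close, so having a logarithm is locally constant along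
the connected interval. -/
theorem hasLog_iff_of_homotopy [CompactSpace X] {H : unitInterval × X → ℂ} (hH : Continuous H)
    (hne : ∀ q, H q ≠ 0) : HasLog (fun u => H (0, u)) ↔ HasLog (fun u => H (1, u)) := by
  have hloc : IsLocallyConstant fun s : unitInterval => HasLog fun u => H (s, u) := by
    rw [IsLocallyConstant.iff_eventually_eq]
    intro s₀
    have hev : ∀ᶠ s in 𝓝 s₀, ∀ u ∈ (univ : Set X), ‖H (s, u) - H (s₀, u)‖ < ‖H (s₀, u)‖ := by
      refine isCompact_univ.eventually_forall_of_forall_eventually fun u _ => ?_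
      have h1 : ContinuousAt (fun q : unitInterval × X => ‖H q - H (s₀, q.2)‖) (s₀, u) := by
        fun_prop
      have h2 : ContinuousAt (fun q : unitInterval × X => ‖H (s₀, q.2)‖) (s₀, u) := by
        fun_prop
      exact h1.eventually_lt h2 (by simpa using hne _)
    filter_upwards [hev] with s hs
    exact propext (hasLog_iff_of_norm_sub_lt (by fun_prop) (by fun_prop) fun u => hs u trivial)
  exact (hloc.apply_eq_of_preconnectedSpace 0 1).to_iff

instance : PreconnectedSpace (sphere (0 : ℂ) 1) :=
  Subtype.preconnectedSpace (isPreconnected_sphere (by simp [Complex.rank_real_complex]) 0 1)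

/-- For a logarithm `h`, the exponential of `h (-u) - h u` is `-1`. Its imaginary part is odd in
`u`, so it vanishes somewhere on the connected circle, where the exponential would be positive. -/
theorem not_hasLog_of_odd {g : sphere (0 : ℂ) 1 → ℂ} (hg : ∀ u, g (-u) = -g u) : ¬ HasLog g := by
  rintro ⟨h, hc, hexp⟩
  have hd : Continuous fun u : sphere (0 : ℂ) 1 => (h (-u) - h u).im := by fun_prop
  have key : ∀ u, Complex.exp (h (-u) - h u) = -1 := fun u => by
    have hne : g u ≠ 0 := by rw [← hexp]; exact Complex.exp_ne_zero _
    rw [Complex.exp_sub, hexp, hexp, hg, neg_div, div_self hne]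
  have hzero : ∃ u : sphere (0 : ℂ) 1, (h (-u) - h u).im = 0 := by
    let u₀ : sphere (0 : ℂ) 1 := ⟨1, by simp⟩
    have hodd : (h (-(-u₀)) - h (-u₀)).im = -(h (-u₀) - h u₀).im := by
      rw [neg_neg, ← Complex.neg_im, neg_sub]
    rcases le_total (h (-u₀) - h u₀).im 0 with hle | hle
    · exact mem_range_of_exists_le_of_exists_ge hd ⟨u₀, hle⟩ ⟨-u₀, by rw [hodd]; linarith⟩
    · exact mem_range_of_exists_le_of_exists_ge hd ⟨-u₀, by rw [hodd]; linarith⟩ ⟨u₀, hle⟩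
  obtain ⟨u, hu⟩ := hzero
  have hre := congrArg Complex.re (key u)
  rw [Complex.exp_re, hu, Real.cos_zero, mul_one] at hre
  have := Real.exp_pos (h (-u) - h u).re
  simp only [Complex.neg_re, Complex.one_re] at hre
  linarith

end ContinuousLog

/-! ### Planar invariance of domain -/

section InvarianceOfDomain

theorem norm_sphere_one (u : sphere (0 : ℂ) 1) : ‖(u : ℂ)‖ = 1 := by
  simp

/-- Shrinking the circle to its centre is a homotopy to a nonzero constant. -/
theorem hasLog_of_ne_on_closedBall {g : ℂ → ℂ} {c y : ℂ} {r : ℝ} (hr : 0 < r)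
    (hg : ContinuousOn g (closedBall c r)) (hy : ∀ z ∈ closedBall c r, g z ≠ y) :
    HasLog fun u : sphere (0 : ℂ) 1 => g (c + r * u) - y := by
  have hmem : ∀ q : unitInterval × sphere (0 : ℂ) 1,
      c + ((q.1 : ℝ) : ℂ) * (r * q.2) ∈ closedBall c r := fun q => by
    rw [mem_closedBall, dist_eq_norm, add_sub_cancel_left, norm_mul, norm_mul, norm_sphere_one,
      Complex.norm_real, Complex.norm_real, Real.norm_of_nonneg q.1.2.1, Real.norm_of_nonneg hr.le]
    nlinarith [q.1.2.2]
  have hH : Continuous fun q : unitInterval × sphere (0 : ℂ) 1 =>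
      g (c + ((q.1 : ℝ) : ℂ) * (r * q.2)) - y :=
    (hg.comp_continuous (by fun_prop) hmem).sub continuous_const
  have := (hasLog_iff_of_homotopy hH fun q => sub_ne_zero.2 (hy _ (hmem q))).1
    (by simpa using HasLog.const (sub_ne_zero.2 (hy c (mem_closedBall_self hr.le))))
  simpa using this

/-- The homotopy ends at the odd map `f (c + r u / 2) - f (c - r u / 2)`. The two arguments always
differ by `r u`, so injectivity keeps it nonzero. -/
theorem not_hasLog_of_injOn_closedBall {f : ℂ → ℂ} {c : ℂ} {r : ℝ} (hr : 0 < r)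
    (hf : ContinuousOn f (closedBall c r)) (hinj : InjOn f (closedBall c r)) :
    ¬ HasLog fun u : sphere (0 : ℂ) 1 => f (c + r * u) - f c := by
  have hpos : ∀ s : unitInterval, (0 : ℝ) < 1 + s := fun s => by linarith [s.2.1]
  have hmem : ∀ q : unitInterval × sphere (0 : ℂ) 1,
      c + ((r / (1 + q.1) : ℝ) : ℂ) * q.2 ∈ closedBall c r := fun q => by
    rw [mem_closedBall, dist_eq_norm, add_sub_cancel_left, norm_mul, norm_sphere_one,
      Complex.norm_real, Real.norm_of_nonneg (div_pos hr (hpos _)).le, mul_one]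
    exact div_le_self hr.le (by linarith [q.1.2.1])
  have hmem' : ∀ q : unitInterval × sphere (0 : ℂ) 1,
      c - ((q.1 * r / (1 + q.1) : ℝ) : ℂ) * q.2 ∈ closedBall c r := fun q => by
    rw [mem_closedBall, dist_eq_norm, sub_sub_cancel_left, norm_neg, norm_mul, norm_sphere_one,
      Complex.norm_real, Real.norm_of_nonneg (div_nonneg (mul_nonneg q.1.2.1 hr.le) (hpos _).le),
      mul_one, div_le_iff₀ (hpos _)]
    nlinarith [q.1.2.1]
  have hH : Continuous fun q : unitInterval × sphere (0 : ℂ) 1 =>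
      f (c + ((r / (1 + q.1) : ℝ) : ℂ) * q.2) - f (c - ((q.1 * r / (1 + q.1) : ℝ) : ℂ) * q.2) := by
    have h1 : Continuous fun q : unitInterval × sphere (0 : ℂ) 1 => r / (1 + (q.1 : ℝ)) :=
      continuous_const.div (by fun_prop) fun q => (hpos _).ne'
    have h2 : Continuous fun q : unitInterval × sphere (0 : ℂ) 1 =>
        (q.1 : ℝ) * r / (1 + (q.1 : ℝ)) :=
      Continuous.div (by fun_prop) (by fun_prop) fun q => (hpos _).ne'
    exact (hf.comp_continuous (by fun_prop) hmem).sub (hf.comp_continuous (by fun_prop) hmem')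
  have hne : ∀ q : unitInterval × sphere (0 : ℂ) 1,
      f (c + ((r / (1 + q.1) : ℝ) : ℂ) * q.2) -
        f (c - ((q.1 * r / (1 + q.1) : ℝ) : ℂ) * q.2) ≠ 0 := fun q h => by
    have h1 := hinj (hmem q) (hmem' q) (sub_eq_zero.1 h)
    have h2 : ((r / (1 + q.1) + q.1 * r / (1 + q.1) : ℝ) : ℂ) * q.2 = 0 := by
      push_cast at h1 ⊢
      linear_combination h1
    have h3 : r / (1 + q.1) + q.1 * r / (1 + q.1) = r := by
      have := (hpos q.1).ne'
      field_simp
    rw [h3] at h2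
    have h4 := congrArg norm h2
    rw [norm_mul, norm_sphere_one, Complex.norm_real, Real.norm_of_nonneg hr.le, norm_zero] at h4
    linarith
  have hiff := hasLog_iff_of_homotopy hH hne
  intro hlog
  refine not_hasLog_of_odd ?_ (hiff.1 (by simpa using hlog))
  intro u
  simp only [unitInterval, Icc.coe_one, one_mul, coe_neg_sphere, mul_neg, neg_sub, sub_neg_eq_add,
    ← sub_eq_add_neg]

/-- Stable form of invariance of domain in the complex plane. -/
theorem exists_forall_mem_image_closedBall {f : ℂ → ℂ} {c : ℂ} {r : ℝ} (hr : 0 < r)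
    (hf : ContinuousOn f (closedBall c r)) (hinj : InjOn f (closedBall c r)) :
    ∃ ε > 0, ∀ g : ℂ → ℂ, ContinuousOn g (closedBall c r) →
      (∀ z ∈ closedBall c r, dist (g z) (f z) < ε) → ∀ y, dist y (f c) < ε →
        ∃ z ∈ closedBall c r, g z = y := by
  have hmem : ∀ u : sphere (0 : ℂ) 1, c + r * (u : ℂ) ∈ closedBall c r := fun u => by
    rw [mem_closedBall, dist_eq_norm, add_sub_cancel_left, norm_mul, norm_sphere_one,
      Complex.norm_real, Real.norm_of_nonneg hr.le, mul_one]
  have hne : ∀ u : sphere (0 : ℂ) 1, f (c + r * u) - f c ≠ 0 := fun u h => by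
    have h1 := hinj (hmem u) (mem_closedBall_self hr.le) (sub_eq_zero.1 h)
    have h2 := congrArg norm (add_eq_left.1 h1)
    rw [norm_mul, norm_sphere_one, Complex.norm_real, Real.norm_of_nonneg hr.le, norm_zero] at h2
    linarith
  have hfc : Continuous fun u : sphere (0 : ℂ) 1 => f (c + r * u) - f c :=
    (hf.comp_continuous (by fun_prop) hmem).sub continuous_const
  -- Half the distance from `f c` to the image of the circle serves as `ε`: one half for moving `f`
  -- to `g`, one for moving `f c` to `y`.
  obtain ⟨u₀, -, hu₀⟩ := isCompact_univ.exists_isMinOn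
    (⟨⟨1, by simp⟩, trivial⟩ : (univ : Set (sphere (0 : ℂ) 1)).Nonempty) hfc.norm.continuousOn
  have hpos := norm_pos_iff.2 (hne u₀)
  refine ⟨_, half_pos hpos, fun g hg hgf y hy => ?_⟩
  by_contra! hcon
  refine not_hasLog_of_injOn_closedBall hr hf hinj ((hasLog_iff_of_norm_sub_lt hfc
    ((hg.comp_continuous (by fun_prop) hmem).sub continuous_const) fun u => ?_).1
      (hasLog_of_ne_on_closedBall hr hg hcon))
  have h1 := hgf _ (hmem u)
  have h2 := hu₀ (mem_univ u)
  rw [dist_eq_norm] at h1 hy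
  simp only [mem_ofPred_eq] at h2
  calc ‖g (c + r * u) - y - (f (c + r * u) - f c)‖
      = ‖(g (c + r * u) - f (c + r * u)) - (y - f c)‖ := by congr 1; ring
    _ ≤ ‖g (c + r * u) - f (c + r * u)‖ + ‖y - f c‖ := norm_sub_le _ _
    _ < ‖f (c + r * u) - f c‖ := by linarith

theorem exists_forall_mem_image_closedBall_plane {f : Plane → Plane} {c : Plane} {r : ℝ}
    (hr : 0 < r) (hf : ContinuousOn f (closedBall c r)) (hinj : InjOn f (closedBall c r)) :
    ∃ ε > 0, ∀ g : Plane → Plane, ContinuousOn g (closedBall c r) →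
      (∀ z ∈ closedBall c r, dist (g z) (f z) < ε) → ∀ y, dist y (f c) < ε →
        ∃ z ∈ closedBall c r, g z = y := by
  let e : ℂ ≃ₗᵢ[ℝ] Plane := Complex.orthonormalBasisOneI.repr
  have hmaps : ∀ z ∈ closedBall (e.symm c) r, e z ∈ closedBall c r := fun z hz => by
    rwa [mem_closedBall, ← e.symm.dist_map, e.symm_apply_apply]
  have hcont : ∀ g : Plane → Plane, ContinuousOn g (closedBall c r) →
      ContinuousOn (fun z => e.symm (g (e z))) (closedBall (e.symm c) r) := fun g hg =>
    e.symm.continuous.comp_continuousOn (hg.comp e.continuous.continuousOn hmaps)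
  obtain ⟨ε, hε, h⟩ := exists_forall_mem_image_closedBall hr (hcont f hf)
    fun z hz w hw hzw => e.injective (hinj (hmaps z hz) (hmaps w hw) (e.symm.injective hzw))
  refine ⟨ε, hε, fun g hg hgf y hy => ?_⟩
  obtain ⟨z, hz, hzy⟩ := h _ (hcont g hg)
    (fun z hz => by rw [e.symm.dist_map]; exact hgf _ (hmaps z hz)) (e.symm y)
    (by rwa [e.symm.dist_map, e.apply_symm_apply])
  exact ⟨e z, hmaps z hz, e.symm.injective hzy⟩

end InvarianceOfDomain

/-! ### Coordinates on space and oriented lines -/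

section Lift

theorem lift_add (p q : Plane) (a b : ℝ) : lift p a + lift q b = lift (p + q) (a + b) := by
  ext i; fin_cases i <;> simp [lift]

theorem smul_lift (t : ℝ) (p : Plane) (a : ℝ) : t • lift p a = lift (t • p) (t * a) := by
  ext i; fin_cases i <;> simp [lift]

@[simp] theorem lift_apply_two (p : Plane) (a : ℝ) : lift p a 2 = a := by simp [lift]

theorem lift_add_smul_lift (p b : Plane) (t : ℝ) :
    lift p 0 + t • lift b 1 = lift (p + t • b) t := by
  rw [smul_lift, lift_add, zero_add, mul_one]

/-- The horizontal part of a vector of `ℝ³`. -/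
noncomputable def horiz (x : Space) : Plane := !₂[x 0, x 1]

@[simp] theorem horiz_lift (p : Plane) (a : ℝ) : horiz (lift p a) = p := by
  ext i; fin_cases i <;> simp [lift, horiz]

theorem lift_horiz (x : Space) : lift (horiz x) (x 2) = x := by
  ext i; fin_cases i <;> simp [lift, horiz]

theorem horiz_smul (t : ℝ) (x : Space) : horiz (t • x) = t • horiz x := by
  ext i; fin_cases i <;> simp [horiz]

@[fun_prop]
theorem continuous_horiz : Continuous horiz := by
  unfold horiz
  refine (PiLp.continuous_toLp 2 _).comp (continuous_pi fun i => ?_)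
  fin_cases i <;> simp <;> fun_prop

@[fun_prop]
theorem Continuous.lift {Y : Type*} [TopologicalSpace Y] {p : Y → Plane} {a : Y → ℝ}
    (hp : Continuous p) (ha : Continuous a) : Continuous fun y => lift (p y) (a y) := by
  unfold LineFibration.lift
  refine (PiLp.continuous_toLp 2 _).comp (continuous_pi fun i => ?_)
  fin_cases i <;> simp <;> fun_prop

theorem norm_lift_one_pos (b : Plane) : 0 < ‖lift b 1‖ := by
  refine norm_pos_iff.2 fun h => ?_
  have := congrArg (fun x : Space => x 2) h
  simp at this

theorem lift_mem_region {E : Set Plane} {p b : Plane} (hp : p ∈ E) (t : ℝ) :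
    lift (p + t • b) t ∈ region E := by
  rintro ⟨h0, hE⟩
  have ht : t = 0 := by simpa [plane₀] using h0
  subst ht
  exact hE ⟨p, hp, by simp⟩

theorem exists_of_mem_region {E : Set Plane} {x : Space} (hx : x ∈ region E) (h0 : x 2 = 0) :
    ∃ p ∈ E, lift p 0 = x := by
  by_contra hcon
  exact hx ⟨h0, hcon⟩

theorem orientedLine_eq {x v : Space} (s : ℝ) {k : ℝ} (hk : 0 < k) :
    orientedLine (x + s • v) (k • v) = orientedLine x v := by
  refine Prod.ext (Subset.antisymm ?_ ?_) ?_
  · rintro _ ⟨t, rfl⟩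
    exact ⟨s + t * k, by simp only; module⟩
  · rintro _ ⟨t, rfl⟩
    refine ⟨(t - s) / k, ?_⟩
    simp only [smul_smul, div_mul_cancel₀ _ hk.ne']
    module
  · simp only [orientedLine, norm_smul, Real.norm_of_nonneg hk.le, smul_smul]
    congr 1
    field_simp

end Lift

/-! ### From a fibration to the two conditions -/

section Necessity

variable {E : Set Plane} {B : Plane → Plane} {V : Space → Space}

theorem apply_lift_of_fibration (hV : IsLineFibration (region E) V)
    (hL : graphLines E B = {l | ∃ x ∈ region E, l = orientedLine x (V x)}) {p : Plane}
    (hp : p ∈ E) (t : ℝ) : V (lift (p + t • B p) t) = ‖lift (B p) 1‖⁻¹ • lift (B p) 1 := by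
  have hmem : orientedLine (lift p 0) (lift (B p) 1) ∈ graphLines E B := ⟨p, hp, rfl⟩
  rw [hL] at hmem
  obtain ⟨x, hx, hl⟩ := hmem
  have h1 := congrArg Prod.fst hl
  have h2 := congrArg Prod.snd hl
  simp only [orientedLine, hV.norm_eq_one x hx, inv_one, one_smul] at h1 h2
  have h3 : lift (p + t • B p) t ∈ range fun t : ℝ => x + t • V x := by
    rw [← h1]
    exact ⟨t, lift_add_smul_lift _ _ _⟩
  obtain ⟨s, hs⟩ := h3
  rw [← hs, hV.apply_line x hx, h2]

theorem exists_of_fibration (hL : graphLines E B = {l | ∃ x ∈ region E, l = orientedLine x (V x)}) {x : Space}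
    (hx : x ∈ region E) : ∃ p ∈ E, x = lift (p + x 2 • B p) (x 2) := by
  have hmem : orientedLine x (V x) ∈ graphLines E B := by rw [hL]; exact ⟨x, hx, rfl⟩
  obtain ⟨p, hp, hl⟩ := hmem
  have h1 : x ∈ range fun t : ℝ => lift p 0 + t • lift (B p) 1 := by
    rw [show (range fun t : ℝ => lift p 0 + t • lift (B p) 1) = range fun t : ℝ => x + t • V x from
      (congrArg Prod.fst hl).symm]
    exact ⟨0, by simp⟩
  obtain ⟨t, ht⟩ := h1
  simp only [lift_add_smul_lift] at ht
  refine ⟨p, hp, ?_⟩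
  rw [← ht, lift_apply_two]

/-- The slope `b` of the vector `c (b, 1)`. -/
noncomputable def slope (v : Space) : Plane := (v 2)⁻¹ • horiz v

theorem slope_smul_lift {k : ℝ} (hk : k ≠ 0) (b : Plane) : slope (k • lift b 1) = b := by
  simp [slope, horiz_smul, hk]

theorem slope_apply_lift (hV : IsLineFibration (region E) V)
    (hL : graphLines E B = {l | ∃ x ∈ region E, l = orientedLine x (V x)}) {p : Plane}
    (hp : p ∈ E) (t : ℝ) : slope (V (lift (p + t • B p) t)) = B p := by
  rw [apply_lift_of_fibration hV hL hp, slope_smul_lift (inv_ne_zero (norm_lift_one_pos _).ne')]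

theorem not_multiple_of_fibers (h : Fibers (graphLines E B) (region E)) :
    ∀ p ∈ E, ∀ q ∈ E, p ≠ q → ∀ c : ℝ, p - q ≠ c • (B p - B q) := by
  obtain ⟨V, hV, hL⟩ := h
  intro p hp q hq hpq c hc
  -- The two lines would meet at height `-c`.
  have h1 : p + (-c) • B p = q + (-c) • B q := by
    rw [sub_eq_iff_eq_add] at hc
    nth_rewrite 1 [hc]
    module
  have h2 : B p = B q := by
    rw [← slope_apply_lift hV hL hp (-c), ← slope_apply_lift hV hL hq (-c), h1]
  rw [h2, sub_self, smul_zero, sub_eq_zero] at hc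
  exact hpq hc

/-- If the images return infinitely often to a ball, a subsequence of them converges; the continuous
inverse `z ↦ z - t • slope (V (lift z t))` carries it to a subsequence of `u` converging in `E`. -/
theorem tendsto_of_fibers (h : Fibers (graphLines E B) (region E)) (u : ℕ → Plane)
    (hu : ∀ n, u n ∈ E) (hacc : ∀ a ∈ E, ¬ MapClusterPt a atTop u) (t : ℝ) (ht : t ≠ 0) :
    Tendsto (fun n => ‖u n + t • B (u n)‖) atTop atTop := by
  obtain ⟨V, hV, hL⟩ := h
  by_contra hcon
  obtain ⟨R, hR⟩ : ∃ R, ∃ᶠ n in atTop, u n + t • B (u n) ∈ closedBall (0 : Plane) R := by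
    rw [Filter.tendsto_atTop] at hcon
    push Not at hcon
    obtain ⟨R, hR⟩ := hcon
    refine ⟨R, hR.mono fun n hn => ?_⟩
    rw [mem_closedBall_zero_iff]
    exact hn.le
  obtain ⟨y, -, φ, hφ, hlim⟩ := (isCompact_closedBall (0 : Plane) R).tendsto_subseq' hR
  have hreg : ∀ z : Plane, lift z t ∈ region E := fun z hz => ht (by simpa [plane₀] using hz.1)
  obtain ⟨p, hp, hpy⟩ := exists_of_fibration hL (hreg y)
  rw [lift_apply_two] at hpy
  have hVc : Continuous fun z : Plane => V (lift z t) :=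
    hV.continuousOn.comp_continuous (by fun_prop) hreg
  have hV2 : ∀ z : Plane, V (lift z t) 2 ≠ 0 := fun z => by
    obtain ⟨q, hq, hqz⟩ := exists_of_fibration hL (hreg z)
    rw [hqz, lift_apply_two, apply_lift_of_fibration hV hL hq]
    simpa using (norm_lift_one_pos (B q)).ne'
  have hinv : Continuous fun z : Plane => z - t • slope (V (lift z t)) := by
    have h1 : Continuous fun z : Plane => V (lift z t) 2 :=
      (PiLp.continuous_apply 2 (fun _ : Fin 3 => ℝ) 2).comp hVc
    have h2 : Continuous fun z : Plane => horiz (V (lift z t)) := continuous_horiz.comp hVc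
    exact continuous_id.sub (((h1.inv₀ hV2).smul h2).const_smul t)
  have hinv_apply : ∀ q ∈ E, (q + t • B q) - t • slope (V (lift (q + t • B q) t)) = q :=
    fun q hq => by rw [slope_apply_lift hV hL hq, add_sub_cancel_right]
  have hyp : y = p + t • B p := by simpa using congrArg horiz hpy
  have hlim' : Tendsto (u ∘ φ) atTop (𝓝 p) := by
    have := (hinv.tendsto y).comp hlim
    rw [hyp, hinv_apply p hp] at this
    exact this.congr fun n => hinv_apply _ (hu _)
  exact hacc p hp (hlim'.mapClusterPt.of_comp hφ.tendsto_atTop)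

end Necessity

/-! ### From the two conditions to a fibration -/

section Sufficiency

variable {E : Set Plane} {B : Plane → Plane}

theorem injOn_add_smul (h : ∀ p ∈ E, ∀ q ∈ E, p ≠ q → ∀ c : ℝ, p - q ≠ c • (B p - B q)) (t : ℝ) :
    InjOn (fun p => p + t • B p) E := by
  intro p hp q hq hpq
  by_contra hne
  refine h p hp q hq hne (-t) ?_
  have h1 : p = q + t • B q - t • B p := eq_sub_of_add_eq hpq
  rw [smul_sub]
  nth_rewrite 1 [h1]
  module

/-- Changing the height is a uniformly small perturbation on a compact ball, as `B` is bounded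
there. The set `W` localises the solution `q`, which later gives continuity of the base point. -/
theorem eventually_exists_mem (hE : IsOpen E) (hB : ContinuousOn B E)
    (hinj : ∀ t : ℝ, InjOn (fun p => p + t • B p) E) {p : Plane} (hp : p ∈ E) (t : ℝ)
    {W : Set Plane} (hW : W ∈ 𝓝 p) :
    ∀ᶠ x in 𝓝 (lift (p + t • B p) t), ∃ q ∈ E ∩ W, q + x 2 • B q = horiz x := by
  obtain ⟨r, hr, hrW⟩ := nhds_basis_closedBall.mem_iff.1 (inter_mem (hE.mem_nhds hp) hW)
  have hBr : ContinuousOn B (closedBall p r) := hB.mono fun q hq => (hrW hq).1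
  have hc : ∀ s : ℝ, ContinuousOn (fun q => q + s • B q) (closedBall p r) := fun s =>
    continuousOn_id.add (hBr.const_smul s)
  obtain ⟨ε, hε, h⟩ := exists_forall_mem_image_closedBall_plane hr (hc t)
    ((hinj t).mono fun q hq => (hrW hq).1)
  obtain ⟨M, hM⟩ := (isCompact_closedBall p r).exists_bound_of_continuousOn hBr
  have hM0 : 0 ≤ M := (norm_nonneg _).trans (hM p (mem_closedBall_self hr.le))
  have e1 : ∀ᶠ x in 𝓝 (lift (p + t • B p) t), |x 2 - t| * M < ε := by
    have hcont : Continuous fun x : Space => |x 2 - t| * M := by fun_prop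
    exact hcont.continuousAt.eventually_lt continuousAt_const (by simpa using hε)
  have e2 : ∀ᶠ x in 𝓝 (lift (p + t • B p) t), dist (horiz x) (p + t • B p) < ε := by
    have hcont : Continuous fun x : Space => dist (horiz x) (p + t • B p) := by fun_prop
    exact hcont.continuousAt.eventually_lt continuousAt_const (by simpa using hε)
  filter_upwards [e1, e2] with x hx1 hx2
  obtain ⟨q, hq, hqx⟩ := h _ (hc (x 2)) (fun z hz => by
    rw [dist_eq_norm, add_sub_add_left_eq_sub, ← sub_smul, norm_smul, Real.norm_eq_abs]
    exact (mul_le_mul_of_nonneg_left (hM z hz) (abs_nonneg _)).trans_lt hx1) _ hx2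
  exact ⟨q, hrW hq, hqx⟩

/-- The image is nonempty and clopen in the connected plane. -/
theorem image_add_smul_eq_univ (hE : IsOpen E) (hne : E.Nonempty) (hB : ContinuousOn B E)
    (hinj : ∀ t : ℝ, InjOn (fun p => p + t • B p) E)
    (hprop : ∀ u : ℕ → Plane, (∀ n, u n ∈ E) → (∀ a ∈ E, ¬ MapClusterPt a atTop u) →
      ∀ t : ℝ, t ≠ 0 → Tendsto (fun n => ‖u n + t • B (u n)‖) atTop atTop)
    {t : ℝ} (ht : t ≠ 0) : (fun p => p + t • B p) '' E = univ := by
  refine IsClopen.eq_univ ⟨?_, ?_⟩ (hne.image _)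
  · refine isClosed_of_closure_subset fun y hy => ?_
    obtain ⟨v, hv, hlim⟩ := mem_closure_iff_seq_limit.1 hy
    choose u hu huv using hv
    have hlim' : Tendsto (fun n => u n + t • B (u n)) atTop (𝓝 y) :=
      hlim.congr fun n => (huv n).symm
    have hacc : ∃ a ∈ E, MapClusterPt a atTop u := by
      by_contra! hcon
      exact not_tendsto_nhds_of_tendsto_atTop (hprop u hu hcon t ht) _ hlim'.norm
    obtain ⟨a, ha, hau⟩ := hacc
    obtain ⟨φ, hφ, hφa⟩ := hau.tendsto_subseq
    have hBa : Tendsto (fun n => B (u (φ n))) atTop (𝓝 (B a)) :=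
      (hB.continuousAt (hE.mem_nhds ha)).tendsto.comp hφa
    exact ⟨a, ha, tendsto_nhds_unique (hφa.add (hBa.const_smul t))
      (hlim'.comp hφ.tendsto_atTop)⟩
  · refine isOpen_iff_mem_nhds.2 ?_
    rintro _ ⟨p, hp, rfl⟩
    have hcont : Continuous fun y : Plane => lift y t := by fun_prop
    filter_upwards [(hcont.tendsto _).eventually
      (eventually_exists_mem hE hB hinj hp t univ_mem)] with y hy
    obtain ⟨q, hq, hqy⟩ := hy
    exact ⟨q, hq.1, by simpa using hqy⟩

theorem fibers_of_conditions (hE : IsOpen E) (hne : E.Nonempty) (hB : ContinuousOn B E)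
    (hmul : ∀ p ∈ E, ∀ q ∈ E, p ≠ q → ∀ c : ℝ, p - q ≠ c • (B p - B q))
    (hprop : ∀ u : ℕ → Plane, (∀ n, u n ∈ E) → (∀ a ∈ E, ¬ MapClusterPt a atTop u) →
      ∀ t : ℝ, t ≠ 0 → Tendsto (fun n => ‖u n + t • B (u n)‖) atTop atTop) :
    Fibers (graphLines E B) (region E) := by
  have hinj := injOn_add_smul hmul
  have hex : ∀ x : Space, ∃ p, x ∈ region E → p ∈ E ∧ p + x 2 • B p = horiz x := fun x => by
    by_cases hx : x ∈ region E
    · by_cases h0 : x 2 = 0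
      · obtain ⟨p, hp, rfl⟩ := exists_of_mem_region hx h0
        exact ⟨p, fun _ => ⟨hp, by simp⟩⟩
      · have := image_add_smul_eq_univ hE hne hB hinj hprop h0 ▸ mem_univ (horiz x)
        obtain ⟨p, hp, hpx⟩ := this
        exact ⟨p, fun _ => ⟨hp, hpx⟩⟩
    · exact ⟨0, fun h => absurd h hx⟩
  -- `P x` is the foot in `E` of the line through `x`.
  choose P hP using hex
  have hPlift : ∀ p ∈ E, ∀ t : ℝ, P (lift (p + t • B p) t) = p := fun p hp t => by
    obtain ⟨h1, h2⟩ := hP _ (lift_mem_region (b := B p) hp t)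
    rw [lift_apply_two, horiz_lift] at h2
    exact hinj t h1 hp h2
  have hxP : ∀ x ∈ region E, lift (P x + x 2 • B (P x)) (x 2) = x := fun x hx => by
    rw [(hP x hx).2, lift_horiz]
  have hPc : ContinuousOn P (region E) := fun x hx => by
    refine tendsto_def.2 fun W hW => ?_
    have hev := eventually_exists_mem hE hB hinj (hP x hx).1 (x 2) hW
    rw [hxP x hx] at hev
    refine mem_nhdsWithin_of_mem_nhds ?_
    -- Near `x` there is a foot in `W`; by injectivity it is `P y`.
    filter_upwards [hev] with y hy
    obtain ⟨q, hq, hqy⟩ := hy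
    rw [mem_preimage, ← lift_horiz y, ← hqy, hPlift q hq.1]
    exact hq.2
  have hBP : ContinuousOn (fun x => lift (B (P x)) 1) (region E) :=
    (Continuous.lift continuous_id continuous_const).comp_continuousOn
      (hB.comp hPc fun x hx => (hP x hx).1)
  let k : Space → ℝ := fun x => ‖lift (B (P x)) 1‖⁻¹
  have hk : ∀ x, 0 < k x := fun x => inv_pos.2 (norm_lift_one_pos _)
  have hline : ∀ x ∈ region E, ∀ t : ℝ, x + t • (k x • lift (B (P x)) 1) =
      lift (P x + (x 2 + t * k x) • B (P x)) (x 2 + t * k x) := fun x hx t => by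
    nth_rewrite 1 [← hxP x hx]
    rw [smul_smul, smul_lift, lift_add, mul_one, add_smul, add_assoc]
  refine ⟨fun x => k x • lift (B (P x)) 1, ⟨?_, ?_, ?_, ?_⟩, ?_⟩
  · exact (hBP.norm.inv₀ fun x _ => (norm_lift_one_pos _).ne').smul hBP
  · intro x _
    rw [norm_smul, Real.norm_of_nonneg (hk x).le]
    exact inv_mul_cancel₀ (norm_lift_one_pos _).ne'
  · intro x hx t
    rw [hline x hx]
    exact lift_mem_region (hP x hx).1 _
  · intro x hx t
    have hPx : P (x + t • (k x • lift (B (P x)) 1)) = P x := by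
      rw [hline x hx, hPlift _ (hP x hx).1]
    simp only [k] at hPx ⊢
    rw [hPx]
  · have hL : ∀ x ∈ region E,
        orientedLine x (k x • lift (B (P x)) 1) = orientedLine (lift (P x) 0) (lift (B (P x)) 1) :=
      fun x hx => by
        nth_rewrite 1 [← hxP x hx]
        rw [← lift_add_smul_lift, orientedLine_eq _ (hk x)]
    ext l
    constructor
    · rintro ⟨p, hp, rfl⟩
      have hx : lift p 0 ∈ region E := by simpa using lift_mem_region (b := 0) hp 0
      refine ⟨lift p 0, hx, ?_⟩
      have hPp : P (lift p 0) = p := by simpa using hPlift p hp 0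
      rw [hL _ hx, hPp]
    · rintro ⟨x, hx, rfl⟩
      exact ⟨P x, (hP x hx).1, hL x hx⟩

end Sufficiency

end LineFibration

theorem mainTheorem7 (E : Set LineFibration.Plane) (hE : IsOpen E) (hne : E.Nonempty)
    (B : LineFibration.Plane → LineFibration.Plane) (hB : ContinuousOn B E) :
    LineFibration.Fibers (LineFibration.graphLines E B) (LineFibration.region E) ↔
      (∀ p ∈ E, ∀ q ∈ E, p ≠ q → ∀ c : ℝ, p - q ≠ c • (B p - B q)) ∧
      (∀ u : ℕ → LineFibration.Plane, (∀ n, u n ∈ E) →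
        (∀ a ∈ E, ¬ MapClusterPt a atTop u) →
        ∀ t : ℝ, t ≠ 0 → Tendsto (fun n => ‖u n + t • B (u n)‖) atTop atTop) :=
  ⟨fun h => ⟨LineFibration.not_multiple_of_fibers h, LineFibration.tendsto_of_fibers h⟩,
    fun h => LineFibration.fibers_of_conditions hE hne hB h.1 h.2⟩
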